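/- All models have at least two elements. Inclusion logic ($\mathsf{Inc}$) extends first-order logic by inclusion atoms $\mathsf u\subseteq\mathsf v$ ($\mathsf u,\mathsf v$ sequences of variables of the same length), with negation applied only to first-order formulas. It is evaluated in teams (sets $X$ of assignments with a common domain) by lax team semantics: $M\models_X\alpha$ iff $M\models_s\alpha$ for all $s\in X$ ($\alpha$ first-order); $M\models_X\mathsf u\subseteq\mathsf v$ iff for every $s\in X$ there is $s'\in X$ with $s(\mathsf u)=s'(\mathsf v)$; $\wedge$ is evaluated componentwise; $M\models_X\varphi\vee\psi$ iff $X=Y\cup Z$ with $M\models_Y\varphi$ and $M\models_Z\psi$; $M\models_X\exists x\varphi$ iff $M\models_{X'}\varphi$ with $X'=\{s(a/x): s\in X,\,a\in F(s)\}$ for some $F:X\to\wp(M)\setminus\{\emptyset\}$; $M\models_X\forall x\varphi$ iff $M\models_{X'}\varphi$ with $X'=\{s(a/x): s\in X,\,a\in M\}$. For a sentence $\theta$, $M\models\theta$ means $M\models_{\{\emptyset\}}\theta$, where $\{\emptyset\}$ is the team consisting of the empty assignment only. Formulas are (semantically) equivalent if they are satisfied by the same teams in all models. Let $\phi$ be an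 $\mathsf{Inc}$-sentence and let $$\exists\mathsf w\,\exists\mathsf x\,\forall y\Big(\bigwedge_{i\in I}\rho^i_{\mathsf w}\subseteq\sigma^i_{\mathsf w}\wedge\bigwedge_{j\in J}\pi^j_{\mathsf x}y\subseteq\tau^j_{\mathsf x}\wedge\alpha(\mathsf w,\mathsf x)\Big)\qquad(*)$$ be a sentence in normal form that is equivalent to $\phi$ (possibly $\phi$ itself), where $I,J$ are finite, $\rho^i_{\mathsf w},\sigma^i_{\mathsf w}$ are sequences of variables from $\mathsf w$, $\pi^j_{\mathsf x},\tau^j_{\mathsf x}$ are sequences of variables from $\mathsf x$, and $\alpha$ is first-order and quantifier-free. Define layers of indices $\xi$, each index standing for a copy $\mathsf w_\xi\mathsf x_\xi$ of $\mathsf w\mathsf x$, as follows. Layer $0$ consists of the single index $0$. Layer $n\ge1$ consists of an index $\langle\xi,i\rangle$ for each $\xi$ in layer $n-1$ and $i\in I$, and of an index $\langle\xi\eta,j\rangle$ for each $\xi\eta\in A_n$ and $j\in J$, where $A_n$ is the set of pairs $\xi\eta$ with $\xi$ in a layer $\le n-1$ and $\eta\in\{0,\dots,n-1\}$ which are in none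 of $A_1,\dots,A_{n-1}$; put $A_0=\emptyset$. Let $\mathsf w^n\mathsf x^n$ list all $\mathsf w_\xi\mathsf x_\xi$ with $\xi$ in layer $n$, and put $$\alpha_n=\bigwedge_{\xi\text{ in layer }n}\alpha(\mathsf w_\xi,\mathsf x_\xi),\qquad \gamma_n=\bigwedge_{\xi\text{ in layer }n-1}\ \bigwedge_{i\in I}\rho^i_{\mathsf w_\xi}=\sigma^i_{\mathsf w_{\langle\xi,i\rangle}},\qquad \delta_n=\bigwedge_{\xi\eta\in A_n}\ \bigwedge_{j\in J}\pi^j_{\mathsf x_\xi}y_\eta=\tau^j_{\mathsf x_{\langle\xi\eta,j\rangle}},$$ with $\gamma_0=\delta_0=\top$. The $n$-approximation of $\phi$ is the first-order sentence $$\Phi_n=\exists\mathsf w^0\mathsf x^0\forall y_0\big(\alpha_0\wedge\gamma_0\wedge\delta_0\wedge\exists\mathsf w^1\mathsf x^1\forall y_1\big(\alpha_1\wedge\gamma_1\wedge\delta_1\wedge\dots\wedge\exists\mathsf w^n\mathsf x^n\forall y_n(\alpha_n\wedge\gamma_n\wedge\delta_n)\cdots\big)\big),$$ and the game expression $\Phi$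 is the infinitary sentence obtained by continuing this through all $n<\omega$. By definition $M\models\Phi$ means that $\exists$loise has a winning strategy in the following game: in round $n=0,1,2,\dots$ she chooses values in $M$ for $\mathsf w^n\mathsf x^n$, after which $\forall$belard chooses a value for $y_n$; she wins if the resulting assignment satisfies $\alpha_n\wedge\gamma_n\wedge\delta_n$ for every $n<\omega$. A model $M$ of a countable signature with a fixed numbering of its symbols is recursively saturated if for every recursive set $\{\varphi_n(\mathsf x,\mathsf y)\mid n<\omega\}$ of first-order formulas (recursive in terms of Gödel numbers; $\mathsf x,\mathsf y$ finite sequences of variables) $$M\models\forall\mathsf x\Big(\bigwedge_{n<\omega}\exists\mathsf y\bigwedge_{m\le n}\varphi_m(\mathsf x,\mathsf y)\to\exists\mathsf y\bigwedge_{n<\omega}\varphi_n(\mathsf x,\mathsf y)\Big).$$ **Theorem.** If $M$ is a recursively saturated model (with respect to some numbering of the symbols) or a finite model, then $$M\models\Phi\iff M\models\Phi_n\text{ for all }n<\omega.$$ If in addition $M$ is countable (in particular, if $M$ is finite), then $$M\models\phi\iff M\models\Phi_n\text{ for all }n<\omega.$$ -/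

import Mathlib

open FirstOrder

universe u v w

noncomputable section

namespace InclusionLogic

/-! ### Inclusion logic and its team semantics -/

/-- Formulas of inclusion logic with free variables `0, …, n - 1`; the quantifiers bind the last
variable. First-order formulas `α` enter through `fo`; in particular `⊥` and every negated
first-order formula `¬α` is of this shape. -/
inductive IncFormula (L : FirstOrder.Language.{u, v}) : ℕ → Type (max u v)
  | fo {n : ℕ} (α : L.Formula (Fin n)) : IncFormula L n
  | incl {n k : ℕ} (x y : Fin k → Fin n) : IncFormula L n
  | and {n : ℕ} (φ ψ : IncFormula L n) : IncFormula L n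
  | or {n : ℕ} (φ ψ : IncFormula L n) : IncFormula L n
  | ex {n : ℕ} (φ : IncFormula L (n + 1)) : IncFormula L n
  | all {n : ℕ} (φ : IncFormula L (n + 1)) : IncFormula L n

/-- Sentences of inclusion logic. -/
abbrev IncSentence (L : FirstOrder.Language.{u, v}) : Type (max u v) := IncFormula L 0

namespace IncFormula

variable {L : FirstOrder.Language.{u, v}}

/-- Lax team semantics `M ⊨_X φ`. A team with domain `{0, …, n - 1}` is a set of assignments
`Fin n → M`, and `Fin.snoc s a` is the assignment `s(a/x)` for the newly bound variable `x`. -/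
def Sat (M : Type w) [L.Structure M] : {n : ℕ} → Set (Fin n → M) → IncFormula L n → Prop
  | _, X, fo α => ∀ s ∈ X, α.Realize s
  | _, X, incl x y => ∀ s ∈ X, ∃ s' ∈ X, s ∘ x = s' ∘ y
  | _, X, and φ ψ => Sat M X φ ∧ Sat M X ψ
  | _, X, or φ ψ => ∃ Y Z : Set (_ → M), X = Y ∪ Z ∧ Sat M Y φ ∧ Sat M Z ψ
  | n, X, ex φ => ∃ F : (Fin n → M) → Set M, (∀ s ∈ X, (F s).Nonempty) ∧
      Sat M {t | ∃ s ∈ X, ∃ a ∈ F s, t = Fin.snoc (α := fun _ => M) s a} φ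
  | _, X, all φ => Sat M {t | ∃ s ∈ X, ∃ a : M, t = Fin.snoc (α := fun _ => M) s a} φ

/-- `M ⊨ θ` for a sentence `θ`: satisfaction by the team `{∅}` whose only member is the empty
assignment. -/
def Models (M : Type w) [L.Structure M] (θ : IncSentence L) : Prop :=
  Sat M ({Fin.elim0} : Set (Fin 0 → M)) θ

/-- Semantic equivalence over all models (with at least two elements) and all teams. -/
def SemEquiv {n : ℕ} (φ ψ : IncFormula L n) : Prop :=
  ∀ (M : Type w) [L.Structure M] [Nontrivial M] (X : Set (Fin n → M)), Sat M X φ ↔ Sat M X ψ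

/-- Finite conjunctions (the empty one is `⊤`). -/
def conj {n : ℕ} (l : List (IncFormula L n)) : IncFormula L n :=
  l.foldr and (fo ⊤)

/-- Existential quantification of all free variables. -/
def exs : {n : ℕ} → IncFormula L n → IncSentence L
  | 0, φ => φ
  | _ + 1, φ => exs (ex φ)

end IncFormula

/-! ### Sentences in normal form -/

/-- The data of an inclusion logic sentence in normal form
`∃ w ∃ x ∀ y (⋀_{i ∈ I} ρ^i_w ⊆ σ^i_w ∧ ⋀_{j ∈ J} π^j_x y ⊆ τ^j_x ∧ α(w, x))`
with `w = (w_0, …, w_{p-1})`, `x = (x_0, …, x_{q-1})`, `I = Fin a`, `J = Fin b`. -/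
structure NormalForm (L : FirstOrder.Language.{u, v}) where
  /-- the length of the sequence `w` -/
  p : ℕ
  /-- the length of the sequence `x` -/
  q : ℕ
  /-- the size of the index set `I` -/
  a : ℕ
  /-- the size of the index set `J` -/
  b : ℕ
  /-- the length of the sequences `ρ^i_w` and `σ^i_w` -/
  lenI : Fin a → ℕ
  /-- the left-hand sides `ρ^i_w`, as positions in `w` -/
  ρ : (i : Fin a) → Fin (lenI i) → Fin p
  /-- the right-hand sides `σ^i_w`, as positions in `w` -/
  σ : (i : Fin a) → Fin (lenI i) → Fin p
  /-- the length of the sequence `π^j_x` -/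
  lenJ : Fin b → ℕ
  /-- the sequences `π^j_x`, as positions in `x` -/
  π : (j : Fin b) → Fin (lenJ j) → Fin q
  /-- the right-hand sides `τ^j_x`, as positions in `x` -/
  τ : (j : Fin b) → Fin (lenJ j + 1) → Fin q
  /-- the first-order part `α(w, x)` -/
  α : L.Formula (Fin p ⊕ Fin q)
  /-- `α` is quantifier-free -/
  qf : α.IsQF

/-- Indices `ξ` of the rows of variables `w_ξ x_ξ` of the game expression: `root` is the index of
`w_0 x_0`, `inc ξ i` is the index `⟨ξ, i⟩` of the witness for `ρ^i_w ⊆ σ^i_w` with respect to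
`w_ξ`, and `univ ξ η j` is the index `⟨ξη, j⟩` of the witness for `π^j_x y ⊆ τ^j_x` with respect
to `x_ξ y_η`. -/
inductive Idx (a b : ℕ) : Type
  | root : Idx a b
  | inc (ξ : Idx a b) (i : Fin a) : Idx a b
  | univ (ξ : Idx a b) (η : ℕ) (j : Fin b) : Idx a b

/-- The layer in which a row is introduced. The rows of layer `n` are those with index in
`E_n ∪ U_n`: the rows `inc ξ i` with `ξ ∈ E_n ∪ U_n` form `E_{n+1}`, and the rows `univ ξ η j` with
`ξη ∈ A_{n+1}` form `U_{n+1}`. Here `A_{n+1}` is the set of new pairs `ξη`, that is, of those with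
`x_ξ` from `x^0, …, x^n` and `y_η` from `y_0, …, y_n` which are in no earlier `A_m`; equivalently
`max (layer ξ) η = n`. -/
def Idx.layer {a b : ℕ} : Idx a b → ℕ
  | .root => 0
  | .inc ξ _ => ξ.layer + 1
  | .univ ξ η _ => max ξ.layer η + 1

theorem Idx.finite_layer_lt (a b n : ℕ) : {ξ : Idx a b | ξ.layer < n}.Finite := by
  induction n with
  | zero => simp
  | succ n ih =>
    have h₁ := (ih.prod (Set.finite_univ (α := Fin a))).image
      (fun t : Idx a b × Fin a => Idx.inc t.1 t.2)
    have h₂ := (ih.prod ((Set.finite_Iio n).prod (Set.finite_univ (α := Fin b)))).image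
      (fun t : Idx a b × (ℕ × Fin b) => Idx.univ t.1 t.2.1 t.2.2)
    refine (((Set.finite_singleton Idx.root).union h₁).union h₂).subset ?_
    rintro (_ | ⟨ξ, i⟩ | ⟨ξ, η, j⟩) h
    · exact Or.inl (Or.inl rfl)
    · refine Or.inl (Or.inr ⟨(ξ, i), ⟨?_, trivial⟩, rfl⟩)
      simp only [Set.mem_ofPred_eq, Idx.layer] at h ⊢
      omega
    · refine Or.inr ⟨(ξ, η, j), ⟨?_, ?_, trivial⟩, rfl⟩ <;>
      · simp only [Set.mem_ofPred_eq, Idx.layer, Set.mem_Iio] at h ⊢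
        omega

namespace NormalForm

variable {L : FirstOrder.Language.{u, v}} (D : NormalForm L)

/-- The position of `w_i` in the list of variables `w x y`. -/
def wVar (i : Fin D.p) : Fin (D.p + D.q + 1) := (Fin.castAdd D.q i).castSucc

/-- The position of `x_i` in the list of variables `w x y`. -/
def xVar (i : Fin D.q) : Fin (D.p + D.q + 1) := (Fin.natAdd D.p i).castSucc

/-- The position of `y` in the list of variables `w x y`. -/
def yVar : Fin (D.p + D.q + 1) := Fin.last _

/-- The sentence `∃ w ∃ x ∀ y (⋀_i ρ^i_w ⊆ σ^i_w ∧ ⋀_j π^j_x y ⊆ τ^j_x ∧ α(w, x))`. -/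
def toInc : IncSentence L :=
  .exs (n := D.p + D.q) <| .all <|
    .and (.conj (List.ofFn fun i => .incl (D.wVar ∘ D.ρ i) (D.wVar ∘ D.σ i))) <|
    .and (.conj (List.ofFn fun j =>
      .incl (Fin.snoc (α := fun _ => Fin (D.p + D.q + 1)) (D.xVar ∘ D.π j) D.yVar)
        (D.xVar ∘ D.τ j))) <|
    .fo (FirstOrder.Language.Formula.relabel (Sum.elim D.wVar D.xVar) D.α)

/-! ### The game expression and its approximations -/

/-- The row indices in layer `n`, i.e. the elements of `E_n ∪ U_n`. -/
abbrev Layer (n : ℕ) : Type := {ξ : Idx D.a D.b // ξ.layer = n}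

/-- The pairs `ξη` in `A_n`; there are none for `n = 0`. -/
abbrev NewPair (n : ℕ) : Type := {t : Idx D.a D.b × ℕ // max t.1.layer t.2 + 1 = n}

/-- The rows `ξ` in the layer preceding layer `n`; there are none for `n = 0`. -/
abbrev PrevLayer (n : ℕ) : Type := {ξ : Idx D.a D.b // ξ.layer + 1 = n}

instance (n : ℕ) : Finite (D.Layer n) :=
  ((Idx.finite_layer_lt D.a D.b (n + 1)).subset fun ξ (h : ξ.layer = n) => by
    simp only [Set.mem_ofPred_eq]; omega).to_subtype

instance (n : ℕ) : Finite (D.PrevLayer n) :=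
  ((Idx.finite_layer_lt D.a D.b n).subset fun ξ (h : ξ.layer + 1 = n) => by
    simp only [Set.mem_ofPred_eq]; omega).to_subtype

instance (n : ℕ) : Finite (D.NewPair n) :=
  (((Idx.finite_layer_lt D.a D.b n).prod (Set.finite_Iio n)).subset
    fun t (h : max t.1.layer t.2 + 1 = n) => by
      simp only [Set.mem_prod, Set.mem_ofPred_eq, Set.mem_Iio]; omega).to_subtype

/-- The variables of the game expression: `row ξ (inl i)` is the `i`-th entry of `w_ξ`,
`row ξ (inr i)` is the `i`-th entry of `x_ξ`, and `y n` is `y_n`. -/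
inductive GameVar : Type
  | row (ξ : Idx D.a D.b) (c : Fin D.p ⊕ Fin D.q) : GameVar
  | y (n : ℕ) : GameVar

/-- The layer of the game expression in which a variable is quantified. -/
def GameVar.stage {D : NormalForm L} : D.GameVar → ℕ
  | .row ξ _ => ξ.layer
  | .y n => n

/-- The variables quantified in the layers before layer `n`. -/
abbrev Before (n : ℕ) : Type := {z : D.GameVar // z.stage < n}

/-- The variables `w^n x^n`, existentially quantified at the beginning of layer `n`. -/
abbrev Block (n : ℕ) : Type := D.Layer n × (Fin D.p ⊕ Fin D.q)

/-- `α_n = ⋀_{ξ ∈ E_n ∪ U_n} α(w_ξ, x_ξ)`. -/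
def alphaConj (n : ℕ) : L.Formula (D.Before (n + 1)) :=
  FirstOrder.Language.Formula.iInf fun ξ : D.Layer n =>
    FirstOrder.Language.Formula.relabel
      (fun c => ⟨.row ξ.1 c, by have := ξ.2; simp only [GameVar.stage]; omega⟩) D.α

/-- `γ_n = ⋀_ξ ⋀_{i ∈ I} ρ^i_{w_ξ} = σ^i_{w_{ξ,i}}`, over the rows `ξ` of layer `n - 1`. -/
def gammaConj (n : ℕ) : L.Formula (D.Before (n + 1)) :=
  FirstOrder.Language.Formula.iInf fun t : D.PrevLayer n × Fin D.a =>
    FirstOrder.Language.Formula.iInf fun r : Fin (D.lenI t.2) =>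
      FirstOrder.Language.Term.equal
        (.var ⟨.row t.1.1 (.inl (D.ρ t.2 r)),
          by have := t.1.2; simp only [GameVar.stage]; omega⟩)
        (.var ⟨.row (.inc t.1.1 t.2) (.inl (D.σ t.2 r)),
          by have := t.1.2; simp only [GameVar.stage, Idx.layer]; omega⟩)

/-- `δ_n = ⋀_{ξη ∈ A_n} ⋀_{j ∈ J} π^j_{x_ξ} y_η = τ^j_{x_{ξη,j}}`. -/
def deltaConj (n : ℕ) : L.Formula (D.Before (n + 1)) :=
  FirstOrder.Language.Formula.iInf fun t : D.NewPair n × Fin D.b =>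
    (FirstOrder.Language.Formula.iInf fun r : Fin (D.lenJ t.2) =>
      FirstOrder.Language.Term.equal
        (.var ⟨.row t.1.1.1 (.inr (D.π t.2 r)),
          by have := t.1.2; simp only [GameVar.stage]; omega⟩)
        (.var ⟨.row (.univ t.1.1.1 t.1.1.2 t.2) (.inr (D.τ t.2 r.castSucc)),
          by have := t.1.2; simp only [GameVar.stage, Idx.layer]; omega⟩)) ⊓
    FirstOrder.Language.Term.equal
      (.var ⟨.y t.1.1.2, by have := t.1.2; simp only [GameVar.stage]; omega⟩)
      (.var ⟨.row (.univ t.1.1.1 t.1.1.2 t.2) (.inr (D.τ t.2 (Fin.last _))),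
        by have := t.1.2; simp only [GameVar.stage, Idx.layer]; omega⟩)

/-- `α_n ∧ γ_n ∧ δ_n`. -/
def cond (n : ℕ) : L.Formula (D.Before (n + 1)) :=
  D.alphaConj n ⊓ D.gammaConj n ⊓ D.deltaConj n

/-- A variable occurring up to layer `n` is quantified before layer `n`, or is in `w^n x^n`, or
is `y_n`. -/
def split (n : ℕ) : D.Before (n + 1) → (D.Before n ⊕ D.Block n) ⊕ Unit
  | ⟨.row ξ c, h⟩ =>
      if h' : ξ.layer < n then .inl (.inl ⟨.row ξ c, h'⟩)
      else .inl (.inr (⟨ξ, by simp only [GameVar.stage] at h; omega⟩, c))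
  | ⟨.y m, _⟩ => if h' : m < n then .inl (.inl ⟨.y m, h'⟩) else .inr ()

/-- The quantifier prefix `∃ w^n x^n ∀ y_n` of layer `n`. -/
def quant (n : ℕ) (ψ : L.Formula (D.Before (n + 1))) : L.Formula (D.Before n) :=
  FirstOrder.Language.Formula.iExs (D.Block n)
    (FirstOrder.Language.Formula.iAlls Unit (FirstOrder.Language.Formula.relabel (D.split n) ψ))

/-- The layers `k, …, k + m` of the game expression, as a finite formula
`∃ w^k x^k ∀ y_k (α_k ∧ γ_k ∧ δ_k ∧ … ∃ w^{k+m} x^{k+m} ∀ y_{k+m} (α_{k+m} ∧ γ_{k+m} ∧ δ_{k+m}))`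
whose free variables are quantified before layer `k`. -/
def layers : (m k : ℕ) → L.Formula (D.Before k)
  | 0, k => D.quant k (D.cond k)
  | m + 1, k => D.quant k (D.cond k ⊓ layers m (k + 1))

/-- The `n`-approximation `Φ_n`, a first-order sentence. -/
def approx (n : ℕ) : L.Sentence :=
  FirstOrder.Language.Formula.relabel (fun z : D.Before 0 => absurd z.2 (Nat.not_lt_zero _)) (D.layers n 0)

/-- A strategy of ∃loise in the infinite game `G(M, Φ)`: in round `n` she chooses values for
`w^n x^n`, depending on the moves of ∀belard for `y_0, …, y_{n-1}`. -/
abbrev Strategy (M : Type w) : Type w := (n : ℕ) → (Fin n → M) → D.Block n → M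

/-- The assignment generated when ∃loise follows the strategy `S` and ∀belard plays
`c_0, c_1, …` for `y_0, y_1, …`. -/
def play {D : NormalForm L} {M : Type w} (S : D.Strategy M) (c : ℕ → M) : D.GameVar → M
  | .row ξ e => S ξ.layer (fun i => c i) (⟨ξ, rfl⟩, e)
  | .y n => c n

/-- `M ⊨ Φ` for the infinitary game expression `Φ`: ∃loise has a strategy such that all plays
following it satisfy `α_n ∧ γ_n ∧ δ_n` for all `n`. -/
def ModelsGame (M : Type w) [L.Structure M] : Prop :=
  ∃ S : D.Strategy M, ∀ (c : ℕ → M) (n : ℕ), (D.cond n).Realize fun z => play S c z.1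

end NormalForm

/-! ### Recursively saturated models -/

/-- The Gödel number of a formula, relative to a numbering of the function symbols and of the
relation symbols. -/
def godelNumber {L : FirstOrder.Language.{u, v}} [Encodable (Σ n, L.Functions n)]
    [Encodable (Σ n, L.Relations n)] {β : Type} [Encodable β] (φ : L.Formula β) : ℕ :=
  Encodable.encode φ.listEncode

/-- `M` is recursively saturated: for every recursive set `{φ_n(x, y) | n < ω}` of formulas,
`M ⊨ ∀ x (⋀_n ∃ y ⋀_{m ≤ n} φ_m(x, y) → ∃ y ⋀_n φ_n(x, y))`. -/
def IsRecursivelySaturated (L : FirstOrder.Language.{u, v}) [Encodable (Σ n, L.Functions n)]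
    [Encodable (Σ n, L.Relations n)] (M : Type w) [L.Structure M] : Prop :=
  ∀ (k l : ℕ) (φ : ℕ → L.Formula (Fin k ⊕ Fin l)),
    ComputablePred (fun c : ℕ => ∃ n, godelNumber (φ n) = c) →
    ∀ x : Fin k → M,
      (∀ n, ∃ y : Fin l → M, ∀ m ≤ n, (φ m).Realize (Sum.elim x y)) →
      ∃ y : Fin l → M, ∀ n, (φ n).Realize (Sum.elim x y)

end InclusionLogic

end

noncomputable section

namespace InclusionLogic

open FirstOrder.Language Encodable

/-! ### Computability of codes of formulas -/

/-! Call a set of rows closed if it is contained in its image under the monotone operator `step`. In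
a nonempty model, the sentence in normal form and the game expression both hold exactly when there
is a nonempty closed set. For the sentence, such a set is a satisfying team for w x
(`models_toInc_iff`). For the game, the rows occurring in all plays of a winning strategy form a
closed set, and conversely picking witnesses inside a closed set is a winning strategy
(`modelsGame_iff`).

Φ_n only provides an element of `rowStage M n`, the n-th iterate of `step` on the set of all rows
(`rowStage_nonempty`). What remains is that the intersection of all iterates is nonempty and closed:
witnesses that exist for each m separately must be replaced by a single one that lies in every
iterate. Saturation permits this exchange of quantifiers, and in a finite model monotonicity in m
does (`exists_forall_gameStage`).

Saturation only concerns recursive sets of formulas. The iterates are therefore recast as stages of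
a game on finite families of rows (`gameStage_moveFormula_iff`), in which stage m + 1 has the form
∀u ∃x' (H ∧ stage m) and so contains stage m just once. Its code is a prefix, the code of stage m
with shifted variables, and a suffix. Hence the code is primitive recursive in m, and its length
grows with m, which makes the set of codes decidable (`computablePred_stageType`). -/

theorem encode_map_encode {A : Type*} [Encodable A] (l : List A) :
    encode (l.map (encode : A → ℕ)) = encode l := by
  induction l with
  | nil => rfl
  | cons a l ih => simp [encode_list_cons, ih]

theorem primrec_flatMap_of_forall {ι : Type*} (l : List ι) (F : ι → ℕ → List ℕ)
    (h : ∀ i, Primrec (F i)) : Primrec fun r => l.flatMap fun i => F i r := by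
  induction l with
  | nil => exact Primrec.const []
  | cons i l ih => simpa using Primrec.list_append.comp (h i) ih

theorem primrec_cons {f : ℕ → ℕ} {g : ℕ → List ℕ} (hf : Primrec f) (hg : Primrec g) :
    Primrec fun r => f r :: g r :=
  Primrec.list_cons.comp hf hg

theorem encode_fin {n : ℕ} (i : Fin n) : encode i = (i : ℕ) := rfl

section Codes

variable {L : FirstOrder.Language.{u, v}} [Encodable (Σ n, L.Functions n)]

/-- The term is fixed and only its variables move with r, so the codes of its function symbols are
constants and nothing is required of the numbering. -/
theorem primrec_encode_relabel_term {δ : Type} {ε : ℕ → Type} [∀ r, Encodable (ε r)]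
    (f : ∀ r, δ → ε r) (hf : ∀ x, Primrec fun r => encode (f r x)) (t : L.Term δ) :
    Primrec fun r => encode (t.relabel (f r)) := by
  suffices h : Primrec fun r => (t.relabel (f r)).listEncode.map (encode : _ → ℕ) from
    (Primrec.encode.comp h).of_eq fun r => encode_map_encode _
  induction t with
  | var x =>
    simp only [Term.relabel, Term.listEncode, List.map_cons, List.map_nil, encode_inl]
    exact primrec_cons (Primrec.nat_mul.comp (Primrec.const 2) (hf x)) (Primrec.const [])
  | func F ts ih =>
    simp only [Term.relabel, Term.listEncode, List.map_cons, List.map_flatMap, encode_inr]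
    exact primrec_cons (Primrec.const _) (primrec_flatMap_of_forall _ _ ih)

variable [Encodable (Σ n, L.Relations n)]

/-- The list of the codes of the symbols of a formula in Polish notation. -/
def code {β : Type} [Encodable β] {n : ℕ} (φ : L.BoundedFormula β n) : List ℕ :=
  φ.listEncode.map encode

theorem godelNumber_eq {β : Type} [Encodable β] (φ : L.Formula β) :
    godelNumber φ = encode (code (L := L) (n := 0) φ) :=
  (encode_map_encode _).symm

/-- The code of the number `k` as a symbol in a formula. -/
def natCode (k : ℕ) : ℕ := 2 * (2 * k + 1) + 1

theorem primrec_natCode {f : ℕ → ℕ} (hf : Primrec f) : Primrec fun r => natCode (f r) := by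
  have h : Primrec natCode :=
    Primrec.succ.comp (Primrec.nat_mul.comp (Primrec.const 2)
      (Primrec.succ.comp (Primrec.nat_mul.comp (Primrec.const 2) Primrec.id)))
  exact h.comp hf

variable {β : Type} [Encodable β] {n : ℕ}

theorem code_bot : code (⊥ : L.BoundedFormula β n) = [natCode (n + 2)] := rfl

theorem code_imp (φ ψ : L.BoundedFormula β n) :
    code (φ.imp ψ) = natCode 0 :: (code φ ++ code ψ) := by
  simp [code, BoundedFormula.listEncode, natCode]

theorem code_all (φ : L.BoundedFormula β (n + 1)) : code φ.all = natCode 1 :: code φ := rfl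

theorem code_not (φ : L.BoundedFormula β n) :
    code φ.not = natCode 0 :: (code φ ++ [natCode (n + 2)]) := by
  rw [BoundedFormula.not, code_imp, code_bot]

theorem primrec_code_relabel {γ : Type} {κ : ℕ → ℕ} (hκ : Primrec κ)
    (g : ∀ r, γ → β ⊕ Fin (κ r)) (hg : ∀ x, Primrec fun r => encode (g r x))
    (φ : L.BoundedFormula γ n) : Primrec fun r => code (φ.relabel (g r)) := by
  have key : ∀ (n : ℕ) (t : L.Term (γ ⊕ Fin n)), Primrec fun r =>
      encode (Sum.inl ⟨κ r + n, t.relabel (BoundedFormula.relabelAux (g r) n)⟩ :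
        (Σ k, L.Term (β ⊕ Fin k)) ⊕ ((Σ n, L.Relations n) ⊕ ℕ)) := by
    intro n t
    simp only [encode_inl, encode_sigma_val]
    refine Primrec.nat_mul.comp (Primrec.const 2) (Primrec₂.natPair.comp
      (Primrec.encode.comp (Primrec.nat_add.comp hκ (Primrec.const n)))
      (primrec_encode_relabel_term (fun r => BoundedFormula.relabelAux (g r) n) ?_ t))
    rintro (x | j)
    · refine (hg x).of_eq fun r => ?_
      simp only [BoundedFormula.relabelAux, Function.comp_apply, Sum.map_inl]
      rcases g r x with b | i
      · rfl
      · simp [encode_fin]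
    · simp only [BoundedFormula.relabelAux, Function.comp_apply, Sum.map_inr,
        Equiv.sumAssoc_apply_inr, finSumFinEquiv_apply_right, encode_inr, id]
      exact Primrec.succ.comp (Primrec.nat_mul.comp (Primrec.const 2)
        ((Primrec.nat_add.comp hκ (Primrec.const (j : ℕ))).of_eq fun r => by
          simp [encode_fin]))
  induction φ with
  | @falsum n =>
    exact primrec_cons (primrec_natCode (Primrec.nat_add.comp
      (Primrec.nat_add.comp hκ (Primrec.const n)) (Primrec.const 2))) (Primrec.const [])
  | equal t₁ t₂ => exact primrec_cons (key _ t₁) (primrec_cons (key _ t₂) (Primrec.const []))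
  | @rel n l R ts =>
    have h : Primrec fun r => (List.finRange l).flatMap fun i => [encode
        (Sum.inl ⟨κ r + n, (ts i).relabel (BoundedFormula.relabelAux (g r) n)⟩ :
        (Σ k, L.Term (β ⊕ Fin k)) ⊕ ((Σ n, L.Relations n) ⊕ ℕ))] :=
      primrec_flatMap_of_forall _ _ fun i => primrec_cons (key _ (ts i)) (Primrec.const [])
    refine (primrec_cons (Primrec.const
      (encode (Sum.inr (Sum.inl ⟨l, R⟩) :
        (Σ k, L.Term (β ⊕ Fin k)) ⊕ ((Σ n, L.Relations n) ⊕ ℕ))))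
      (primrec_cons (primrec_natCode (Primrec.nat_add.comp hκ (Primrec.const n))) h)).of_eq
      fun r => ?_
    simp only [code, BoundedFormula.relabel, BoundedFormula.mapTermRel, BoundedFormula.listEncode,
      List.cons_append, List.nil_append, List.map_cons, List.map_map, id]
    rw [List.map_eq_flatMap]
    rfl
  | imp φ ψ ih₁ ih₂ =>
    simp only [BoundedFormula.relabel_imp, code_imp]
    exact primrec_cons (Primrec.const _) (Primrec.list_append.comp ih₁ ih₂)
  | all φ ih =>
    simp only [BoundedFormula.relabel_all, code_all]
    exact primrec_cons (Primrec.const _) ih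

end Codes

/-! ### Saturation for uniformly defined sequences of game stages -/

/-- A value c can only be attained at arguments up to c, so membership in the range is a bounded
search. -/
theorem computablePred_range_of_le {f : ℕ → ℕ} (hf : Primrec f) (hle : ∀ n, n ≤ f n) :
    ComputablePred fun c => ∃ n, f n = c := by
  have hR : PrimrecRel fun x y : ℕ => f x = y :=
    Primrec.eq.comp (hf.comp Primrec.fst) Primrec.snd
  have h : PrimrecPred fun c : ℕ => ∃ x < c + 1, f x = c :=
    hR.exists_lt.comp Primrec.succ Primrec.id
  refine (h.of_eq fun c => ⟨?_, ?_⟩).computablePred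
  · rintro ⟨x, -, hx⟩
    exact ⟨x, hx⟩
  · rintro ⟨x, hx⟩
    exact ⟨x, Nat.lt_succ_of_le (hx ▸ hle x), hx⟩

/-- Unrolling removes the recursion with its changing parameter r. The suffixes come out innermost
first, hence the reversed index `m - 1 - i`. -/
theorem nested_list_eq {A : Type*} {l : ℕ → ℕ → List A} {pre post : ℕ → List A} {d : ℕ}
    (hl : ∀ m r, l (m + 1) r = pre r ++ (l m (r + d) ++ post r)) (m r : ℕ) :
    l m r = (List.range m).flatMap (fun i => pre (r + i * d)) ++ (l 0 (r + m * d) ++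
      (List.range m).flatMap fun i => post (r + (m - 1 - i) * d)) := by
  induction m generalizing r with
  | zero => simp
  | succ m ih =>
    have h₁ : (List.range (m + 1)).flatMap (fun i => pre (r + i * d)) =
        pre r ++ (List.range m).flatMap fun i => pre (r + d + i * d) := by
      rw [List.range_succ_eq_map, List.flatMap_cons, List.flatMap_map]
      simp [Nat.succ_mul, Nat.add_assoc, Nat.add_comm d]
    have h₂ : (List.range (m + 1)).flatMap (fun i => post (r + (m + 1 - 1 - i) * d)) =
        ((List.range m).flatMap fun i => post (r + d + (m - 1 - i) * d)) ++ post r := by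
      rw [List.range_succ, List.flatMap_append]
      congr 1
      · refine List.flatMap_congr fun i hi => ?_
        obtain ⟨k, rfl⟩ := Nat.exists_eq_add_of_lt (List.mem_range.1 hi)
        rw [show i + k + 1 + 1 - 1 - i = k + 1 by omega, show i + k + 1 - 1 - i = k by omega]
        congr 1
        ring
      · simp
    rw [hl, ih, h₁, h₂, show r + d + m * d = r + (m + 1) * d by ring]
    simp only [List.append_assoc]

theorem primrec_nested_list {A : Type*} [Primcodable A] {l : ℕ → ℕ → List A}
    {pre post : ℕ → List A} {d : ℕ}
    (hl : ∀ m r, l (m + 1) r = pre r ++ (l m (r + d) ++ post r))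
    (h₀ : Primrec (l 0)) (hpre : Primrec pre) (hpost : Primrec post) :
    Primrec fun m => l m 0 := by
  have hd : Primrec fun i : ℕ => i * d := Primrec.nat_mul.comp Primrec.id (Primrec.const d)
  refine Primrec.of_eq (f := fun m => (List.range m).flatMap (fun i => pre (i * d)) ++
    (l 0 (m * d) ++ (List.range m).flatMap fun i => post ((m - 1 - i) * d))) ?_ fun m => ?_
  · refine Primrec.list_append.comp
      (Primrec.list_flatMap Primrec.list_range ((hpre.comp hd).comp Primrec.snd))
      (Primrec.list_append.comp (h₀.comp hd) (Primrec.list_flatMap Primrec.list_range ?_))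
    exact (hpost.comp hd).comp (Primrec.nat_sub.comp (Primrec.nat_sub.comp Primrec.fst
      (Primrec.const 1)) Primrec.snd)
  · rw [nested_list_eq hl m 0]
    simp only [Nat.zero_add]

theorem le_length_nested_list {A : Type*} {l : ℕ → ℕ → List A} {pre post : ℕ → List A} {d : ℕ}
    (hl : ∀ m r, l (m + 1) r = pre r ++ (l m (r + d) ++ post r)) (hpre : ∀ r, pre r ≠ [])
    (m r : ℕ) : m ≤ (l m r).length := by
  induction m generalizing r with
  | zero => exact Nat.zero_le _
  | succ m ih =>
    have h₁ := ih (r + d)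
    have h₂ := List.length_pos_iff.2 (hpre r)
    rw [hl, List.length_append, List.length_append]
    omega

/-! ### Formulas defining the finite stages of a game -/

section Formulas

variable {L : FirstOrder.Language.{u, v}} {β : Type} {M : Type w} [L.Structure M]

/-- Universal quantification of the last `c` bound variables. -/
def allLast : (c : ℕ) → {n : ℕ} → L.BoundedFormula β (n + c) → L.BoundedFormula β n
  | 0, _, φ => φ
  | c + 1, _, φ => allLast c φ.all

theorem realize_allLast {c n : ℕ} {φ : L.BoundedFormula β (n + c)} {z : β → M} {xs : Fin n → M} :
    (allLast c φ).Realize z xs ↔ ∀ u : Fin c → M, φ.Realize z (Fin.append xs u) := by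
  induction c with
  | zero =>
    rw [allLast, Unique.forall_iff]
    have h : Fin.append xs (default : Fin 0 → M) = xs := by
      rw [Fin.append_right_nil _ _ rfl]
      rfl
    rw [h]
  | succ c ih =>
    rw [allLast, ih]
    simp only [BoundedFormula.realize_all]
    constructor
    · intro h u
      rw [← Fin.snoc_init_self u, Fin.append_snoc]
      exact h _ _
    · intro h u a
      rw [← Fin.append_snoc]
      exact h _

theorem code_allLast [Encodable (Σ n, L.Functions n)] [Encodable (Σ n, L.Relations n)]
    [Encodable β] {c n : ℕ} (φ : L.BoundedFormula β (n + c)) :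
    code (allLast c φ) = List.replicate c (natCode 1) ++ code φ := by
  induction c with
  | zero => rfl
  | succ c ih =>
    rw [allLast, ih, code_all, List.replicate_succ', List.append_assoc]
    rfl

variable {V U : Type}

/-- ∃loise survives `m` rounds of the game in which ∀belard chooses `u`, ∃loise answers with `x'`
satisfying `H(x, u, x')`, and the play continues from `x'`. -/
def GameStage (H : L.Formula ((V ⊕ U) ⊕ V)) (M : Type w) [L.Structure M] : ℕ → (V → M) → Prop
  | 0, _ => True
  | m + 1, x => ∀ y : U → M, ∃ x' : V → M,
      H.Realize (Sum.elim (Sum.elim x y) x') ∧ GameStage H M m x'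

theorem GameStage.of_succ {H : L.Formula ((V ⊕ U) ⊕ V)} {m : ℕ} {x : V → M}
    (h : GameStage H M (m + 1) x) : GameStage H M m x := by
  induction m generalizing x with
  | zero => trivial
  | succ m ih => exact fun y => (h y).imp fun x' hx' => ⟨hx'.1, ih hx'.2⟩

theorem GameStage.mono {H : L.Formula ((V ⊕ U) ⊕ V)} {m n : ℕ} (hmn : m ≤ n) {x : V → M}
    (h : GameStage H M n x) : GameStage H M m x := by
  induction hmn with
  | refl => exact h
  | step _ ih => exact ih h.of_succ

theorem gameStage_relabel {V' U' : Type} (e : V ≃ V') (f : U ≃ U') (H : L.Formula ((V ⊕ U) ⊕ V))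
    (m : ℕ) (x : V' → M) :
    GameStage (H.relabel (Sum.map (Sum.map e f) e)) M m x ↔ GameStage H M m (x ∘ e) := by
  induction m generalizing x with
  | zero => rfl
  | succ m ih =>
    simp only [GameStage, Formula.realize_relabel, Sum.elim_comp_map, ih]
    constructor
    · intro h y
      obtain ⟨x', h₁, h₂⟩ := h (y ∘ f.symm)
      refine ⟨x' ∘ e, ?_, h₂⟩
      rwa [Function.comp_assoc, f.symm_comp_self, Function.comp_id] at h₁
    · intro h y
      obtain ⟨x', h₁, h₂⟩ := h (y ∘ f)
      refine ⟨x' ∘ e.symm, ?_, ?_⟩ <;>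
        rwa [Function.comp_assoc, e.symm_comp_self, Function.comp_id]

variable {b c : ℕ}

/-- The positions of the variables of `H(x, y, x')` as bound variables, starting from `r`. -/
def stagePos (β : Type) (b c r : ℕ) : (Fin b ⊕ Fin c) ⊕ Fin b → β ⊕ Fin (r + b + c + b) :=
  Sum.inr ∘ Sum.elim (Sum.elim (Fin.castAdd b ∘ Fin.castAdd c ∘ Fin.natAdd r)
    (Fin.castAdd b ∘ Fin.natAdd (r + b))) (Fin.natAdd (r + b + c))

theorem primrec_stagePos [Encodable β] (i : (Fin b ⊕ Fin c) ⊕ Fin b) :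
    Primrec fun r => encode (stagePos β b c r i) := by
  have key : ∀ {f : ℕ → ℕ}, Primrec f → Primrec fun r => 2 * f r + 1 := fun hf =>
    Primrec.succ.comp (Primrec.nat_mul.comp (Primrec.const 2) hf)
  rcases i with (i | i) | i
  · exact key (Primrec.nat_add.comp Primrec.id (Primrec.const (i : ℕ)))
  · exact key (Primrec.nat_add.comp (Primrec.nat_add.comp Primrec.id (Primrec.const b))
      (Primrec.const (i : ℕ)))
  · exact key (Primrec.nat_add.comp (Primrec.nat_add.comp (Primrec.nat_add.comp Primrec.id
      (Primrec.const b)) (Primrec.const c)) (Primrec.const (i : ℕ)))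

/-- A formula defining `GameStage H m`, with its variables at the positions `r, …, r + b - 1`. -/
def stageFormula (β : Type) (H : L.Formula ((Fin b ⊕ Fin c) ⊕ Fin b)) :
    ℕ → (r : ℕ) → L.BoundedFormula β (r + b)
  | 0, _ => (⊥ : L.BoundedFormula β _).not
  | m + 1, r =>
    allLast c (allLast b ((BoundedFormula.relabel (k := 0) (stagePos β b c r) H).imp
      (stageFormula β H m (r + b + c)).not)).not

theorem realize_stageFormula (H : L.Formula ((Fin b ⊕ Fin c) ⊕ Fin b)) (m r : ℕ) (z : β → M)
    (xs : Fin (r + b) → M) :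
    (stageFormula β H m r).Realize z xs ↔ GameStage H M m (xs ∘ Fin.natAdd r) := by
  induction m generalizing r with
  | zero => simp [stageFormula, GameStage]
  | succ m ih =>
    simp only [stageFormula, GameStage, realize_allLast, BoundedFormula.realize_not,
      BoundedFormula.realize_imp, not_forall, not_not, exists_prop, ih]
    refine forall_congr' fun y => exists_congr fun x' => and_congr ?_ ?_
    · rw [BoundedFormula.realize_relabel, Formula.Realize]
      refine iff_of_eq ?_
      congr 1
      · funext i
        rcases i with (i | i) | i
        · simp only [stagePos, Function.comp_apply, Sum.elim_inl, Sum.elim_inr]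
          erw [Fin.append_left, Fin.append_left]
        · simp only [stagePos, Function.comp_apply, Sum.elim_inl, Sum.elim_inr]
          erw [Fin.append_left, Fin.append_right]
        · simp only [stagePos, Function.comp_apply, Sum.elim_inr]
          erw [Fin.append_right]
      · exact Subsingleton.elim _ _
    · refine iff_of_eq (congrArg _ (funext fun i => ?_))
      exact Fin.append_right _ _ i

/-- The formula `GameStage H m (x)`, with the free variables `x` on the right. -/
def stageTypeFormula (k : ℕ) (H : L.Formula ((Fin b ⊕ Fin c) ⊕ Fin b)) (m : ℕ) :
    L.Formula (Fin k ⊕ Fin b) :=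
  allLast (n := 0) b ((BoundedFormula.iInf fun i : Fin b =>
    (Term.var (Sum.inl (Sum.inr i))).bdEqual (Term.var (Sum.inr (Fin.natAdd 0 i)))).imp
      (stageFormula _ H m 0))

/-- `stageFormula` reads its arguments from bound variables, so the guard of equations copies the
free variables x into freshly quantified ones. The parameters z do not occur. -/
theorem realize_stageTypeFormula {k : ℕ} (H : L.Formula ((Fin b ⊕ Fin c) ⊕ Fin b)) (m : ℕ)
    (z : Fin k → M) (x : Fin b → M) :
    (stageTypeFormula k H m).Realize (Sum.elim z x) ↔ GameStage H M m x := by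
  have h : ∀ u : Fin b → M, Fin.append (default : Fin 0 → M) u ∘ Fin.natAdd 0 = u := fun u =>
    funext fun i => Fin.append_right _ _ i
  simp only [stageTypeFormula, Formula.Realize, realize_allLast, BoundedFormula.realize_imp,
    BoundedFormula.realize_iInf, BoundedFormula.realize_bdEqual, Term.realize_var, Sum.elim_inl,
    Sum.elim_inr, realize_stageFormula, h, Fin.append_right]
  exact ⟨fun H => H x fun _ => rfl, fun H u hu => funext hu ▸ H⟩

/-! ### Recursiveness of the type expressing survival in all finite stages -/

section Codes

variable [Encodable (Σ n, L.Functions n)] [Encodable (Σ n, L.Relations n)]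

/-- Negation is implication into ⊥, and the symbol for ⊥ records the number of bound variables; the
two negations thus leave a suffix depending on r. One round quantifies b + c new variables, which is
the shift of r. -/
theorem code_stageFormula_succ [Encodable β] (H : L.Formula ((Fin b ⊕ Fin c) ⊕ Fin b))
    (m r : ℕ) :
    code (stageFormula β H (m + 1) r) =
      (List.replicate c (natCode 1) ++ natCode 0 :: (List.replicate b (natCode 1) ++
        natCode 0 :: (code (BoundedFormula.relabel (k := 0) (stagePos β b c r) H) ++
          [natCode 0]))) ++
      (code (stageFormula β H m (r + (b + c))) ++
        [natCode (r + b + c + b + 2), natCode (r + b + c + 2)]) := by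
  -- The two positions index different types of formulas, so the codes are compared through a
  -- variable position.
  have h : code (stageFormula β H m (r + (b + c))) = code (stageFormula β H m (r + b + c)) := by
    have : ∀ r', r' = r + b + c →
        code (stageFormula β H m r') = code (stageFormula β H m (r + b + c)) := by rintro _ rfl; rfl
    exact this _ (Nat.add_assoc r b c).symm
  rw [h]
  simp only [stageFormula, code_allLast, code_not, code_imp]
  simp

theorem primrec_code_stageFormula [Encodable β] (H : L.Formula ((Fin b ⊕ Fin c) ⊕ Fin b)) :
    Primrec fun m => code (stageFormula β H m 0) := by
  have hadd : ∀ {f : ℕ → ℕ} (k : ℕ), Primrec f → Primrec fun r => f r + k := fun k hf =>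
    Primrec.nat_add.comp hf (Primrec.const k)
  have hrep : ∀ (k : ℕ) {f : ℕ → List ℕ}, Primrec f →
      Primrec fun r => List.replicate k (natCode 1) ++ f r := fun k _ hf =>
    Primrec.list_append.comp (Primrec.const _) hf
  have hzero : ∀ {f : ℕ → List ℕ}, Primrec f → Primrec fun r => natCode 0 :: f r := fun hf =>
    primrec_cons (Primrec.const _) hf
  refine primrec_nested_list (l := fun m r => code (stageFormula β H m r))
    (code_stageFormula_succ H) ?_ ?_ ?_
  · simp only [stageFormula, code_not, code_bot]
    have h := primrec_natCode (hadd 2 (hadd b Primrec.id))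
    exact hzero (Primrec.list_append.comp (primrec_cons h (Primrec.const []))
      (primrec_cons h (Primrec.const [])))
  · refine hrep c (hzero (hrep b (hzero (Primrec.list_append.comp ?_ (Primrec.const _)))))
    exact primrec_code_relabel (hadd b (hadd c (hadd b Primrec.id))) _ primrec_stagePos H
  · exact primrec_cons (primrec_natCode (hadd 2 (hadd b (hadd c (hadd b Primrec.id)))))
      (primrec_cons (primrec_natCode (hadd 2 (hadd c (hadd b Primrec.id)))) (Primrec.const []))

/-- The type `{E} ∪ {GameStage H m | m < ω}`. -/
def stageType {k : ℕ} (E : L.Formula (Fin k ⊕ Fin b)) (H : L.Formula ((Fin b ⊕ Fin c) ⊕ Fin b)) :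
    ℕ → L.Formula (Fin k ⊕ Fin b)
  | 0 => E
  | m + 1 => stageTypeFormula k H m

theorem computablePred_stageType {k : ℕ} (E : L.Formula (Fin k ⊕ Fin b))
    (H : L.Formula ((Fin b ⊕ Fin c) ⊕ Fin b)) :
    ComputablePred fun N => ∃ n, godelNumber (stageType E H n) = N := by
  -- `l` codes the quantifiers and the guard, which do not depend on m. Being nonempty, it makes up
  -- for the index shift in `stageType` when the code is bounded below.
  obtain ⟨l, hne, hl⟩ : ∃ l : List ℕ, l ≠ [] ∧ ∀ m, godelNumber (stageType E H (m + 1)) =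
      encode (l ++ code (stageFormula (Fin k ⊕ Fin b) H m 0)) := by
    refine ⟨List.replicate b (natCode 1) ++ natCode 0 :: code (L := L) (n := 0 + b)
      (BoundedFormula.iInf fun i : Fin b => (Term.var (Sum.inl (Sum.inr i : Fin k ⊕ Fin b))).bdEqual
        (Term.var (Sum.inr (Fin.natAdd 0 i)))), by simp, fun m => ?_⟩
    rw [godelNumber_eq, stageType, stageTypeFormula, code_allLast, code_imp]
    simp only [List.append_assoc, List.cons_append]
  refine computablePred_range_of_le ?_ ?_
  · have h : Primrec fun n : ℕ => Nat.casesOn (motive := fun _ => ℕ) n (godelNumber E)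
        fun m => encode (l ++ code (stageFormula (Fin k ⊕ Fin b) H m 0)) :=
      Primrec.nat_casesOn Primrec.id (Primrec.const _) ((Primrec.encode.comp
        (Primrec.list_append.comp (Primrec.const l) (primrec_code_stageFormula H))).comp
          Primrec.snd)
    refine h.of_eq fun n => ?_
    rcases n with _ | m
    · rfl
    · exact (hl m).symm
  · rintro (_ | m)
    · exact Nat.zero_le _
    · have h₁ := length_le_encode (l ++ code (stageFormula (Fin k ⊕ Fin b) H m 0))
      have h₂ := le_length_nested_list
        (l := fun m r => code (stageFormula (Fin k ⊕ Fin b) H m r)) (code_stageFormula_succ H)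
        (by simp) m 0
      have h₃ := List.length_pos_iff.2 hne
      rw [List.length_append] at h₁
      rw [hl]
      omega

end Codes

/-- In a recursively saturated model, ∃loise can survive `ω` rounds if she can survive every finite
number of rounds. -/
theorem IsRecursivelySaturated.exists_forall_gameStage [Encodable (Σ n, L.Functions n)]
    [Encodable (Σ n, L.Relations n)] (hM : IsRecursivelySaturated L M) {K : Type} [Finite K]
    [Finite V] [Finite U] (E : L.Formula (K ⊕ V)) (H : L.Formula ((V ⊕ U) ⊕ V)) (z : K → M)
    (h : ∀ m, ∃ x : V → M, E.Realize (Sum.elim z x) ∧ GameStage H M m x) :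
    ∃ x : V → M, E.Realize (Sum.elim z x) ∧ ∀ m, GameStage H M m x := by
  obtain ⟨k, ⟨eK⟩⟩ := Finite.exists_equiv_fin K
  obtain ⟨b, ⟨e⟩⟩ := Finite.exists_equiv_fin V
  obtain ⟨c, ⟨f⟩⟩ := Finite.exists_equiv_fin U
  have hE : ∀ x : Fin b → M, (E.relabel (Sum.map eK e)).Realize (Sum.elim (z ∘ eK.symm) x) ↔
      E.Realize (Sum.elim z (x ∘ e)) := fun x => by
    rw [Formula.realize_relabel, Sum.elim_comp_map, Function.comp_assoc, eK.symm_comp_self,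
      Function.comp_id]
  obtain ⟨x, hx⟩ := hM k b _ (computablePred_stageType (E.relabel (Sum.map eK e))
    (H.relabel (Sum.map (Sum.map e f) e))) (z ∘ eK.symm) fun n => by
      obtain ⟨x, hx, hm⟩ := h n
      have hxe : (x ∘ e.symm) ∘ e = x := by
        rw [Function.comp_assoc, e.symm_comp_self, Function.comp_id]
      refine ⟨x ∘ e.symm, fun m hmn => ?_⟩
      rcases m with _ | m
      · exact (hE _).2 (hxe.symm ▸ hx)
      · refine (realize_stageTypeFormula _ _ _ _).2 ((gameStage_relabel e f H m _).2 ?_)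
        exact hxe.symm ▸ hm.mono (by omega)
  exact ⟨x ∘ e, (hE x).1 (hx 0), fun m => (gameStage_relabel e f H m x).1
    ((realize_stageTypeFormula _ _ _ _).1 (hx (m + 1)))⟩

/-- If every x failed at some `N x`, then by monotonicity all would fail at a common bound of these
numbers. -/
theorem exists_forall_of_finite {A : Type*} [Finite A] {P : ℕ → A → Prop}
    (hP : ∀ m n x, m ≤ n → P n x → P m x) (h : ∀ m, ∃ x, P m x) : ∃ x, ∀ m, P m x := by
  by_contra! hc
  choose N hN using hc
  obtain ⟨B, hB⟩ := (Set.finite_range N).bddAbove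
  obtain ⟨x, hx⟩ := h B
  exact hN x (hP _ _ x (hB ⟨x, rfl⟩) hx)

/-- The property of recursively saturated models and of finite models that is used for game
expressions. -/
theorem exists_forall_gameStage
    (hM : (∃ (_ : Encodable (Σ n, L.Functions n)) (_ : Encodable (Σ n, L.Relations n)),
      IsRecursivelySaturated L M) ∨ Finite M) {K : Type} [Finite K]
    [Finite V] [Finite U] (E : L.Formula (K ⊕ V)) (H : L.Formula ((V ⊕ U) ⊕ V)) (z : K → M)
    (h : ∀ m, ∃ x : V → M, E.Realize (Sum.elim z x) ∧ GameStage H M m x) :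
    ∃ x : V → M, E.Realize (Sum.elim z x) ∧ ∀ m, GameStage H M m x := by
  rcases hM with ⟨_, _, hM⟩ | hM
  · exact hM.exists_forall_gameStage E H z h
  · obtain ⟨x, hx⟩ := exists_forall_of_finite
      (fun m n x hmn (hx : E.Realize (Sum.elim z x) ∧ GameStage H M n x) =>
        ⟨hx.1, hx.2.mono hmn⟩) h
    exact ⟨x, (hx 0).1, fun m => (hx m).2⟩

end Formulas

variable {L : FirstOrder.Language.{u, v}} {M : Type w} [L.Structure M]

/-! ### Team semantics of sentences in normal form -/

namespace IncFormula

theorem sat_conj {n : ℕ} {X : Set (Fin n → M)} {l : List (IncFormula L n)} :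
    Sat M X (conj l) ↔ ∀ φ ∈ l, Sat M X φ := by
  induction l with
  | nil => simp [conj, Sat, Formula.Realize, BoundedFormula.realize_top]
  | cons φ l ih =>
    rw [List.forall_mem_cons, ← ih]
    rfl

/-- In lax semantics F may be multivalued, so any nonempty team is recovered from its projection by
letting F(s) be the fibre over s. -/
theorem models_exs {n : ℕ} {φ : IncFormula L n} :
    Models M (exs φ) ↔ ∃ X : Set (Fin n → M), X.Nonempty ∧ Sat M X φ := by
  induction n with
  | zero =>
    constructor
    · exact fun h => ⟨_, Set.singleton_nonempty _, h⟩
    · rintro ⟨X, ⟨x, hx⟩, h⟩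
      have hX : X = {Fin.elim0} :=
        Set.eq_singleton_iff_unique_mem.2 ⟨Subsingleton.elim x Fin.elim0 ▸ hx,
          fun _ _ => Subsingleton.elim _ _⟩
      rw [hX] at h
      exact h
  | succ n ih =>
    rw [exs, ih]
    constructor
    · rintro ⟨X, ⟨s, hs⟩, F, hF, h⟩
      obtain ⟨a, ha⟩ := hF s hs
      exact ⟨{t | ∃ s ∈ X, ∃ a ∈ F s, t = Fin.snoc (α := fun _ => M) s a},
        ⟨_, s, hs, a, ha, rfl⟩, h⟩
    · rintro ⟨X, ⟨t, ht⟩, h⟩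
      refine ⟨Fin.init '' X, ⟨_, t, ht, rfl⟩, fun s => {a | Fin.snoc (α := fun _ => M) s a ∈ X},
        ?_, ?_⟩
      · rintro _ ⟨t, ht, rfl⟩
        exact ⟨t (Fin.last n), by simpa using ht⟩
      · convert h using 1
        ext t
        constructor
        · rintro ⟨s, -, a, ha, rfl⟩
          exact ha
        · intro ht
          exact ⟨Fin.init t, ⟨t, ht, rfl⟩, t (Fin.last n), by simpa using ht, by simp⟩

end IncFormula

namespace NormalForm

variable (D : NormalForm L)

/-- The values of a row of variables `w x`. -/
abbrev Row (M : Type w) : Type w := Fin D.p ⊕ Fin D.q → M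

/-- `t` is a witness for `ρ^i_w ⊆ σ^i_w` with respect to `s`. -/
def IncWitness {D : NormalForm L} (i : Fin D.a) (s t : D.Row M) : Prop :=
  ∀ r, s (.inl (D.ρ i r)) = t (.inl (D.σ i r))

/-- `t` is a witness for `π^j_x y ⊆ τ^j_x` with respect to `s` and the value `y`. -/
def UnivWitness {D : NormalForm L} (j : Fin D.b) (s : D.Row M) (y : M) (t : D.Row M) : Prop :=
  (∀ r, s (.inr (D.π j r)) = t (.inr (D.τ j r.castSucc))) ∧ y = t (.inr (D.τ j (Fin.last _)))

/-- The rows which satisfy `α` and have all the required witnesses in `X`. -/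
def step (X : Set (D.Row M)) : Set (D.Row M) :=
  {s | D.α.Realize s ∧ (∀ i, ∃ t ∈ X, IncWitness i s t) ∧ ∀ y j, ∃ t ∈ X, UnivWitness j s y t}

theorem step_mono {X Y : Set (D.Row M)} (h : X ⊆ Y) : D.step X ⊆ D.step Y :=
  fun _ hs => ⟨hs.1, fun i => (hs.2.1 i).imp fun _ ht => ⟨h ht.1, ht.2⟩,
    fun y j => (hs.2.2 y j).imp fun _ ht => ⟨h ht.1, ht.2⟩⟩

/-- The row given by an assignment to the variables `w x`. -/
def rowOf (s : Fin (D.p + D.q) → M) : D.Row M := s ∘ finSumFinEquiv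

theorem rowOf_surjective {M : Type w} : Function.Surjective (D.rowOf (M := M)) := fun r =>
  ⟨r ∘ finSumFinEquiv.symm, by simp [rowOf, Function.comp_assoc]⟩

theorem snoc_wVar {M : Type w} (s : Fin (D.p + D.q) → M) (a : M) (i : Fin D.p) :
    Fin.snoc (α := fun _ => M) s a (D.wVar i) = D.rowOf s (.inl i) :=
  Fin.snoc_castSucc ..

theorem snoc_xVar {M : Type w} (s : Fin (D.p + D.q) → M) (a : M) (i : Fin D.q) :
    Fin.snoc (α := fun _ => M) s a (D.xVar i) = D.rowOf s (.inr i) :=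
  Fin.snoc_castSucc ..

theorem snoc_yVar {M : Type w} (s : Fin (D.p + D.q) → M) (a : M) :
    Fin.snoc (α := fun _ => M) s a D.yVar = a :=
  Fin.snoc_last ..

theorem models_toInc_iff [Nonempty M] :
    D.toInc.Models M ↔ ∃ X : Set (D.Row M), X.Nonempty ∧ X ⊆ D.step X := by
  have hinc : ∀ (s t : Fin (D.p + D.q) → M) (y y' : M) (i : Fin D.a),
      Fin.snoc (α := fun _ => M) s y ∘ (D.wVar ∘ D.ρ i) =
        Fin.snoc (α := fun _ => M) t y' ∘ (D.wVar ∘ D.σ i) ↔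
        IncWitness i (D.rowOf s) (D.rowOf t) := by
    intro s t y y' i
    simp only [funext_iff, Function.comp_apply, snoc_wVar, IncWitness]
  have huniv : ∀ (s t : Fin (D.p + D.q) → M) (y y' : M) (j : Fin D.b),
      Fin.snoc (α := fun _ => M) s y ∘
        (Fin.snoc (α := fun _ => Fin (D.p + D.q + 1)) (D.xVar ∘ D.π j) D.yVar) =
        Fin.snoc (α := fun _ => M) t y' ∘ (D.xVar ∘ D.τ j) ↔
        UnivWitness j (D.rowOf s) y (D.rowOf t) := by
    intro s t y y' j
    simp only [funext_iff, Fin.forall_fin_succ', Function.comp_apply, Fin.snoc_castSucc,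
      Fin.snoc_last, snoc_xVar, snoc_yVar, UnivWitness]
  have hα : ∀ (s : Fin (D.p + D.q) → M) (y : M),
      (Formula.relabel (Sum.elim D.wVar D.xVar) D.α).Realize
        (Fin.snoc (α := fun _ => M) s y) ↔ D.α.Realize (D.rowOf s) := by
    intro s y
    rw [Formula.realize_relabel]
    refine iff_of_eq (congrArg _ (funext fun c => ?_))
    rcases c with i | i
    · exact D.snoc_wVar s y i
    · exact D.snoc_xVar s y i
  have hsat : ∀ X : Set (Fin (D.p + D.q) → M),
      IncFormula.Sat M X (.all <|
        .and (.conj (List.ofFn fun i => .incl (D.wVar ∘ D.ρ i) (D.wVar ∘ D.σ i))) <|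
        .and (.conj (List.ofFn fun j =>
          .incl (Fin.snoc (α := fun _ => Fin (D.p + D.q + 1)) (D.xVar ∘ D.π j) D.yVar)
            (D.xVar ∘ D.τ j))) <|
        .fo (Formula.relabel (Sum.elim D.wVar D.xVar) D.α)) ↔
      D.rowOf '' X ⊆ D.step (D.rowOf '' X) := by
    intro X
    -- `y₀` fills the place of y wherever only the values of w x matter.
    obtain ⟨y₀⟩ := ‹Nonempty M›
    simp only [IncFormula.Sat, IncFormula.sat_conj, List.forall_mem_ofFn_iff]
    constructor
    · rintro ⟨h₁, h₂, h₃⟩ _ ⟨s, hs, rfl⟩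
      refine ⟨(hα s y₀).1 (h₃ _ ⟨s, hs, y₀, rfl⟩), fun i => ?_, fun y j => ?_⟩
      · obtain ⟨_, ⟨t, ht, y', rfl⟩, h⟩ := h₁ i _ ⟨s, hs, y₀, rfl⟩
        exact ⟨_, ⟨t, ht, rfl⟩, (hinc s t y₀ y' i).1 h⟩
      · obtain ⟨_, ⟨t, ht, y', rfl⟩, h⟩ := h₂ j _ ⟨s, hs, y, rfl⟩
        exact ⟨_, ⟨t, ht, rfl⟩, (huniv s t y y' j).1 h⟩
    · intro h
      refine ⟨?_, ?_, ?_⟩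
      · rintro i _ ⟨s, hs, y, rfl⟩
        obtain ⟨_, ⟨t, ht, rfl⟩, hst⟩ := (h ⟨s, hs, rfl⟩).2.1 i
        exact ⟨_, ⟨t, ht, y₀, rfl⟩, (hinc s t y y₀ i).2 hst⟩
      · rintro j _ ⟨s, hs, y, rfl⟩
        obtain ⟨_, ⟨t, ht, rfl⟩, hst⟩ := (h ⟨s, hs, rfl⟩).2.2 y j
        exact ⟨_, ⟨t, ht, y₀, rfl⟩, (huniv s t y y₀ j).2 hst⟩
      · rintro _ ⟨s, hs, y, rfl⟩
        exact (hα s y).2 (h ⟨s, hs, rfl⟩).1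
  rw [toInc, IncFormula.models_exs]
  constructor
  · rintro ⟨X, hX, h⟩
    exact ⟨_, hX.image _, (hsat X).1 h⟩
  · rintro ⟨Y, hY, h⟩
    refine ⟨D.rowOf ⁻¹' Y, hY.preimage D.rowOf_surjective, (hsat _).2 ?_⟩
    rwa [Set.image_preimage_eq _ D.rowOf_surjective]

/-! ### Games and sets of rows -/

/-- The values of the row `ξ` under an assignment to the variables of the game expression. -/
def rowAt {D : NormalForm L} (z : D.GameVar → M) (ξ : Idx D.a D.b) : D.Row M :=
  fun c => z (.row ξ c)

theorem realize_cond {n : ℕ} {z : D.GameVar → M} :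
    (D.cond n).Realize (fun x => z x.1) ↔
      (∀ ξ : Idx D.a D.b, ξ.layer = n → D.α.Realize (rowAt z ξ)) ∧
      (∀ ξ : Idx D.a D.b, ξ.layer + 1 = n → ∀ i,
        IncWitness i (rowAt z ξ) (rowAt z (.inc ξ i))) ∧
      ∀ (ξ : Idx D.a D.b) (η : ℕ), max ξ.layer η + 1 = n → ∀ j,
        UnivWitness j (rowAt z ξ) (z (.y η)) (rowAt z (.univ ξ η j)) := by
  have heq : ∀ {δ : Type} (x y : δ) (f : δ → M),
      (Term.equal (L := L) (.var x) (.var y)).Realize f ↔ f x = f y := by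
    intro δ x y f
    rw [Formula.realize_equal, Term.realize_var, Term.realize_var]
  simp only [cond, alphaConj, gammaConj, deltaConj, Formula.realize_inf, Formula.realize_iInf,
    Formula.realize_relabel, heq, and_assoc]
  refine and_congr ?_ (and_congr ?_ ?_)
  · exact ⟨fun h ξ hξ => h ⟨ξ, hξ⟩, fun h ξ => h ξ.1 ξ.2⟩
  · exact ⟨fun h ξ hξ i => h (⟨ξ, hξ⟩, i), fun h t => h t.1.1 t.1.2 t.2⟩
  · exact ⟨fun h ξ η hξ j => h (⟨(ξ, η), hξ⟩, j), fun h t => h t.1.1.1 t.1.1.2 t.1.2 t.2⟩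

theorem play_congr {M : Type w} {S : D.Strategy M} {c c' : ℕ → M} {ξ : Idx D.a D.b}
    (h : ∀ i < ξ.layer, c i = c' i) : rowAt (play S c) ξ = rowAt (play S c') ξ := by
  have : (fun i : Fin ξ.layer => c i) = fun i : Fin ξ.layer => c' i :=
    funext fun i => h i i.2
  funext e
  simp only [rowAt, play, this]

/-- The closed set consists of all rows produced in all plays against the winning strategy. -/
theorem exists_subset_step_of_modelsGame [Nonempty M] (h : D.ModelsGame M) :
    ∃ X : Set (D.Row M), X.Nonempty ∧ X ⊆ D.step X := by
  obtain ⟨S, hS⟩ := h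
  refine ⟨{s | ∃ c ξ, s = rowAt (play S c) ξ},
    ⟨_, fun _ => Classical.arbitrary M, .root, rfl⟩, ?_⟩
  rintro _ ⟨c, ξ, rfl⟩
  refine ⟨(D.realize_cond.1 (hS c ξ.layer)).1 ξ rfl, fun i => ?_, fun y j => ?_⟩
  · exact ⟨_, ⟨c, _, rfl⟩, (D.realize_cond.1 (hS c (ξ.layer + 1))).2.1 ξ rfl i⟩
  -- A row of layer n depends only on moves before round n. ∀belard can thus play the given value as
  -- y_n without changing the row, and the pair ξ, n is new in layer n + 1.
  · refine ⟨_, ⟨Function.update c ξ.layer y, .univ ξ ξ.layer j, rfl⟩, ?_⟩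
    have h := (D.realize_cond.1 (hS (Function.update c ξ.layer y) (ξ.layer + 1))).2.2 ξ ξ.layer
      (by simp) j
    rw [D.play_congr (c' := c) fun i hi => Function.update_of_ne hi.ne _ _] at h
    simpa only [play, Function.update_self] using h

/-- The row chosen for the index `ξ` by a strategy that picks witnesses one by one, when
∀belard's moves are given by `c`. -/
def witnessRow {D : NormalForm L} (s₀ : D.Row M) (f : Fin D.a → D.Row M → D.Row M)
    (g : Fin D.b → M → D.Row M → D.Row M) (c : ℕ → M) : Idx D.a D.b → D.Row M
  | .root => s₀
  | .inc ξ i => f i (witnessRow s₀ f g c ξ)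
  | .univ ξ η j => g j (c η) (witnessRow s₀ f g c ξ)

theorem witnessRow_congr {M : Type w} {s₀ : D.Row M} {f : Fin D.a → D.Row M → D.Row M}
    {g : Fin D.b → M → D.Row M → D.Row M} {c c' : ℕ → M} {ξ : Idx D.a D.b}
    (h : ∀ i < ξ.layer, c i = c' i) : witnessRow s₀ f g c ξ = witnessRow s₀ f g c' ξ := by
  induction ξ with
  | root => rfl
  | inc ξ i ih =>
    rw [witnessRow, witnessRow, ih fun k hk => h k (Nat.lt_succ_of_lt hk)]
  | univ ξ η j ih =>
    rw [witnessRow, witnessRow, ih fun k hk => h k (by simp only [Idx.layer]; omega),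
      h η (by simp only [Idx.layer]; omega)]

theorem modelsGame_of_subset_step [Nonempty M] {X : Set (D.Row M)} (hX : X.Nonempty)
    (h : X ⊆ D.step X) : D.ModelsGame M := by
  obtain ⟨s₀, hs₀⟩ := hX
  have hf : ∀ (i : Fin D.a) (s : D.Row M), ∃ t, s ∈ X → t ∈ X ∧ IncWitness i s t := by
    intro i s
    by_cases hs : s ∈ X
    · obtain ⟨t, ht⟩ := (h hs).2.1 i
      exact ⟨t, fun _ => ht⟩
    · exact ⟨s, fun hs' => absurd hs' hs⟩
  have hg : ∀ (j : Fin D.b) (y : M) (s : D.Row M), ∃ t, s ∈ X → t ∈ X ∧ UnivWitness j s y t := by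
    intro j y s
    by_cases hs : s ∈ X
    · obtain ⟨t, ht⟩ := (h hs).2.2 y j
      exact ⟨t, fun _ => ht⟩
    · exact ⟨s, fun hs' => absurd hs' hs⟩
  choose f hf using hf
  choose g hg using hg
  have hmem : ∀ (c : ℕ → M) (ξ : Idx D.a D.b), witnessRow s₀ f g c ξ ∈ X := by
    intro c ξ
    induction ξ with
    | root => exact hs₀
    | inc ξ i ih => exact (hf i _ ih).1
    | univ ξ η j ih => exact (hg j _ _ ih).1
  -- Moves not yet made get an arbitrary value; by `witnessRow_congr` the rows of layer n do not see
  -- them.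
  let ext : ∀ n : ℕ, (Fin n → M) → ℕ → M := fun n c k =>
    if hk : k < n then c ⟨k, hk⟩ else Classical.arbitrary M
  let S : D.Strategy M := fun n c e => witnessRow s₀ f g (ext n c) e.1.1 e.2
  have hS : ∀ c ξ, rowAt (play S c) ξ = witnessRow s₀ f g c ξ := by
    intro c ξ
    funext e
    refine congrFun (D.witnessRow_congr fun i hi => ?_) e
    simp only [ext, dif_pos hi]
  refine ⟨S, fun c n => D.realize_cond.2 ?_⟩
  simp only [hS]
  exact ⟨fun ξ _ => (h (hmem c ξ)).1, fun ξ _ i => (hf i _ (hmem c ξ)).2,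
    fun ξ η _ j => (hg j _ _ (hmem c ξ)).2⟩

theorem modelsGame_iff [Nonempty M] :
    D.ModelsGame M ↔ ∃ X : Set (D.Row M), X.Nonempty ∧ X ⊆ D.step X :=
  ⟨D.exists_subset_step_of_modelsGame, fun ⟨_, hX, h⟩ => D.modelsGame_of_subset_step hX h⟩

/-! ### Approximations -/

/-- The assignment `z` after the moves `b` and `y` in round `n`. -/
def updateAt {D : NormalForm L} (z : D.GameVar → M) (n : ℕ) (b : D.Block n → M) (y : M) :
    D.GameVar → M
  | .row ξ c => if h : ξ.layer = n then b (⟨ξ, h⟩, c) else z (.row ξ c)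
  | .y m => if m = n then y else z (.y m)

theorem rowAt_updateAt_of_eq {M : Type w} {z : D.GameVar → M} {n : ℕ} {b : D.Block n → M} {y : M}
    {ξ : Idx D.a D.b} (h : ξ.layer = n) :
    rowAt (updateAt z n b y) ξ = fun c => b (⟨ξ, h⟩, c) :=
  funext fun _ => dif_pos h

theorem rowAt_updateAt_of_ne {M : Type w} {z : D.GameVar → M} {n : ℕ} {b : D.Block n → M} {y : M}
    {ξ : Idx D.a D.b} (h : ξ.layer ≠ n) : rowAt (updateAt z n b y) ξ = rowAt z ξ :=
  funext fun _ => dif_neg h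

theorem realize_quant {n : ℕ} {ψ : L.Formula (D.Before (n + 1))} {z : D.GameVar → M} :
    (D.quant n ψ).Realize (fun x => z x.1) ↔
      ∃ b : D.Block n → M, ∀ y : M, ψ.Realize fun x => updateAt z n b y x.1 := by
  have h : ∀ (b : D.Block n → M) (y : M),
      Sum.elim (Sum.elim (fun x : D.Before n => z x.1) b) (fun _ : Unit => y) ∘ D.split n =
        fun x => updateAt z n b y x.1 := by
    intro b y
    funext x
    rcases x with ⟨⟨ξ, c⟩ | m, hx⟩
    · simp only [GameVar.stage] at hx
      by_cases h' : ξ.layer < n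
      · simp [split, updateAt, h', h'.ne]
      · have h'' : ξ.layer = n := by omega
        simp [split, updateAt, h'']
    · simp only [GameVar.stage] at hx
      by_cases h' : m < n
      · simp [split, updateAt, h', h'.ne]
      · have h'' : m = n := by omega
        simp [split, updateAt, h'']
  simp only [quant, Formula.realize_iExs, Formula.realize_iAlls, Formula.realize_relabel]
  refine exists_congr fun b => ⟨fun H y => h b y ▸ H fun _ => y, fun H y => ?_⟩
  have := H (y ())
  rw [← h] at this
  exact this

theorem realize_approx {n : ℕ} (z : D.GameVar → M) :
    M ⊨ D.approx n ↔ (D.layers n 0).Realize fun x => z x.1 := by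
  rw [Sentence.Realize, approx, Formula.realize_relabel]
  exact iff_of_eq (congrArg _ (funext fun x => absurd x.2 (Nat.not_lt_zero _)))

/-- The strategy's own moves witness each existential block: by `key`, inserting them together with
a move y gives the play against the modified sequence of moves. -/
theorem realize_layers_of_strategy {S : D.Strategy M}
    (hS : ∀ (c : ℕ → M) (n : ℕ), (D.cond n).Realize fun z => play S c z.1) (m k : ℕ)
    (c : ℕ → M) : (D.layers m k).Realize fun z => play S c z.1 := by
  have key : ∀ (k : ℕ) (c : ℕ → M) (y : M),
      (fun x : D.Before (k + 1) => updateAt (play S c) k (S k fun i => c i) y x.1) =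
        fun x => play S (Function.update c k y) x.1 := by
    intro k c y
    funext x
    rcases x with ⟨⟨ξ, e⟩ | n, hx⟩
    · have h := congrFun (D.play_congr (S := S) (c := Function.update c k y) (c' := c) (ξ := ξ)
        fun i hi => Function.update_of_ne (by simp only [GameVar.stage] at hx; omega) _ _) e
      refine Eq.trans ?_ h.symm
      by_cases hk : ξ.layer = k
      · subst hk
        exact dif_pos rfl
      · exact dif_neg hk
    · simp only [updateAt, play, Function.update_apply]
  induction m generalizing k c with
  | zero =>
    refine D.realize_quant.2 ⟨S k fun i => c i, fun y => ?_⟩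
    rw [key]
    exact hS _ k
  | succ m ih =>
    refine D.realize_quant.2 ⟨S k fun i => c i, fun y => ?_⟩
    rw [key, Formula.realize_inf]
    exact ⟨hS _ k, ih _ _⟩

theorem ModelsGame.realize_approx [Nonempty M] {D : NormalForm L} (h : D.ModelsGame M) (n : ℕ) :
    M ⊨ D.approx n := by
  obtain ⟨S, hS⟩ := h
  exact (D.realize_approx (play S fun _ => Classical.arbitrary M)).2
    (D.realize_layers_of_strategy hS n 0 _)

/-- The rows that survive `m` applications of the operator `step`. -/
def rowStage (M : Type w) [L.Structure M] : ℕ → Set (D.Row M)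
  | 0 => Set.univ
  | m + 1 => D.step (rowStage M m)

theorem rowStage_succ_subset (m : ℕ) : D.rowStage M (m + 1) ⊆ D.rowStage M m := by
  induction m with
  | zero => exact Set.subset_univ _
  | succ m ih => exact D.step_mono ih

/-- For ξ in layer k the pair ξ, k belongs to A_{k+1}, so y_k acts as an arbitrary challenge to ξ.
The witnesses lie in layer k + 1, where the induction hypothesis places them in the previous
iterate. -/
theorem exists_block_of_realize_layers [Nonempty M] (m k : ℕ) (z : D.GameVar → M)
    (h : (D.layers m k).Realize fun x => z x.1) :
    ∃ b : D.Block k → M, (∀ y, (D.cond k).Realize fun x => updateAt z k b y x.1) ∧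
      ∀ ξ : D.Layer k, (fun c => b (ξ, c)) ∈ D.rowStage M m := by
  induction m generalizing k z with
  | zero =>
    obtain ⟨b, hb⟩ := D.realize_quant.1 h
    exact ⟨b, hb, fun _ => trivial⟩
  | succ m ih =>
    obtain ⟨b, hb⟩ := D.realize_quant.1 h
    simp only [Formula.realize_inf] at hb
    refine ⟨b, fun y => (hb y).1, fun ξ => ?_⟩
    -- The last `y`, the move in round k + 1, is arbitrary: the condition of layer k + 1 only
    -- involves y_0, …, y_k.
    have key : ∀ y : M, ∃ b' : D.Block (k + 1) → M,
        (D.cond (k + 1)).Realize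
          (fun x => updateAt (updateAt z k b y) (k + 1) b' y x.1) ∧
        ∀ ξ : D.Layer (k + 1), (fun c => b' (ξ, c)) ∈ D.rowStage M m := fun y =>
      (ih (k + 1) _ (hb y).2).imp fun b' hb' => ⟨hb'.1 y, hb'.2⟩
    have hrow : ∀ y b', rowAt (updateAt (updateAt z k b y) (k + 1) b' y) ξ.1 =
        fun c => b (ξ, c) := fun y b' => by
      rw [rowAt_updateAt_of_ne _ (by have := ξ.2; omega), rowAt_updateAt_of_eq _ ξ.2]
    obtain ⟨y₀⟩ := ‹Nonempty M›
    refine ⟨?_, fun i => ?_, fun y j => ?_⟩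
    · have h := (D.realize_cond.1 (hb y₀).1).1 ξ.1 ξ.2
      rwa [rowAt_updateAt_of_eq _ ξ.2] at h
    · obtain ⟨b', h₁, h₂⟩ := key y₀
      have hl : (Idx.inc ξ.1 i).layer = k + 1 := by simp only [Idx.layer, ξ.2]
      have h := (D.realize_cond.1 h₁).2.1 ξ.1 (by rw [ξ.2]) i
      rw [hrow, rowAt_updateAt_of_eq _ hl] at h
      exact ⟨_, h₂ ⟨_, hl⟩, h⟩
    · obtain ⟨b', h₁, h₂⟩ := key y
      have hl : (Idx.univ ξ.1 k j).layer = k + 1 := by simp only [Idx.layer, ξ.2, max_self]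
      have h := (D.realize_cond.1 h₁).2.2 ξ.1 k (by rw [ξ.2, max_self]) j
      rw [hrow, rowAt_updateAt_of_eq _ hl] at h
      refine ⟨_, h₂ ⟨_, hl⟩, ?_⟩
      simpa [updateAt] using h

theorem rowStage_nonempty [Nonempty M] {n : ℕ} (h : M ⊨ D.approx n) :
    (D.rowStage M n).Nonempty := by
  obtain ⟨b, -, hb⟩ := D.exists_block_of_realize_layers n 0 (fun _ => Classical.arbitrary M)
    ((D.realize_approx fun _ => Classical.arbitrary M).1 h)
  exact ⟨_, hb ⟨.root, rfl⟩⟩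

/-! ### The stages of the operator `step` as stages of a game -/

/-- The variables for one row, and for a family of witnesses for it. -/
abbrev FamilyVar : Type := Option (Fin D.a ⊕ Fin D.b) × (Fin D.p ⊕ Fin D.q)

/-- The variables for a row and a value of `y`. -/
abbrev ChallengeVar : Type := (Fin D.p ⊕ Fin D.q) ⊕ Unit

/-- The formula saying that a row satisfies `α` and that a family of rows contains all witnesses
for this row with respect to a given value of `y`. -/
def linkFormula : L.Formula (D.ChallengeVar ⊕ D.FamilyVar) :=
  D.α.relabel (Sum.inl ∘ Sum.inl) ⊓
    (Formula.iInf fun i : Fin D.a => Formula.iInf fun r =>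
      Term.equal (.var (.inl (.inl (.inl (D.ρ i r)))))
        (.var (.inr (some (.inl i), .inl (D.σ i r))))) ⊓
    Formula.iInf fun j : Fin D.b =>
      (Formula.iInf fun r => Term.equal (.var (.inl (.inl (.inr (D.π j r)))))
        (.var (.inr (some (.inr j), .inr (D.τ j r.castSucc))))) ⊓
      Term.equal (.var (.inl (.inr ()))) (.var (.inr (some (.inr j), .inr (D.τ j (Fin.last _)))))

/-- The formula saying that a row belongs to a family of rows. -/
def memFormula : L.Formula (D.FamilyVar ⊕ D.ChallengeVar) :=
  Formula.iSup fun t => Formula.iInf fun c =>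
    Term.equal (.var (.inl (t, c))) (.var (.inr (.inl c)))

/-- The formula saying that if a row belongs to the first family, then it satisfies `α` and has all
witnesses in the second family. -/
def moveFormula : L.Formula ((D.FamilyVar ⊕ D.ChallengeVar) ⊕ D.FamilyVar) :=
  (D.memFormula.relabel Sum.inl).imp (D.linkFormula.relabel (Sum.map Sum.inr id))

theorem realize_linkFormula {u : D.ChallengeVar → M} {x : D.FamilyVar → M} :
    D.linkFormula.Realize (Sum.elim u x) ↔ D.α.Realize (u ∘ Sum.inl) ∧
      (∀ i, IncWitness i (u ∘ Sum.inl) fun c => x (some (.inl i), c)) ∧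
      ∀ j, UnivWitness j (u ∘ Sum.inl) (u (.inr ())) fun c => x (some (.inr j), c) := by
  simp only [linkFormula, Formula.realize_inf, Formula.realize_iInf, Formula.realize_relabel,
    Formula.realize_equal, Term.realize_var, and_assoc]
  rfl

theorem realize_moveFormula {x x' : D.FamilyVar → M} {u : D.ChallengeVar → M} :
    D.moveFormula.Realize (Sum.elim (Sum.elim x u) x') ↔
      ((∃ t, (fun c => x (t, c)) = u ∘ Sum.inl) → D.linkFormula.Realize (Sum.elim u x')) := by
  have h : Sum.elim (Sum.elim x u) x' ∘ Sum.map Sum.inr id = Sum.elim u x' := by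
    rw [Sum.elim_comp_map, Sum.elim_comp_inr, Function.comp_id]
  simp only [moveFormula, memFormula, Formula.realize_imp, Formula.realize_iSup,
    Formula.realize_iInf, Formula.realize_relabel, Formula.realize_equal, Term.realize_var, h,
    Sum.elim_comp_inl, Sum.elim_inl, Sum.elim_inr, funext_iff, Function.comp_apply]

/-- ∀belard points at a member of the family by its values and names a y; the answer is one family
holding the witnesses for all i and j at once. This is why a single copy of the next stage suffices.
-/
theorem gameStage_moveFormula_iff [Nonempty M] (m : ℕ) (x : D.FamilyVar → M) :
    GameStage D.moveFormula M m x ↔ ∀ t, (fun c => x (t, c)) ∈ D.rowStage M m := by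
  induction m generalizing x with
  | zero => exact ⟨fun _ _ => trivial, fun _ => trivial⟩
  | succ m ih =>
    simp only [GameStage, realize_moveFormula, ih, realize_linkFormula]
    constructor
    · intro h t
      have key : ∀ y : M, _ := fun y => h (Sum.elim (fun c => x (t, c)) fun _ => y)
      simp only [Sum.elim_comp_inl, Sum.elim_inr] at key
      obtain ⟨y₀⟩ := ‹Nonempty M›
      obtain ⟨x₀, hx₀, hm₀⟩ := key y₀
      refine ⟨(hx₀ ⟨t, rfl⟩).1, fun i => ⟨_, hm₀ _, (hx₀ ⟨t, rfl⟩).2.1 i⟩, fun y j => ?_⟩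
      obtain ⟨x', hx', hm'⟩ := key y
      exact ⟨_, hm' _, (hx' ⟨t, rfl⟩).2.2 j⟩
    · intro h u
      by_cases ht : ∃ t, (fun c => x (t, c)) = u ∘ Sum.inl
      · obtain ⟨t, ht⟩ := ht
        obtain ⟨h₁, h₂, h₃⟩ := ht ▸ h t
        choose f hf using h₂
        choose g hg using h₃ (u (.inr ()))
        -- The spare slot `none` repeats the challenged row, which stays admissible because the
        -- iterates decrease.
        refine ⟨fun e => (Option.elim e.1 (u ∘ Sum.inl) (Sum.elim f g) : D.Row M) e.2,
          fun _ => ⟨h₁, fun i => (hf i).2, fun j => (hg j).2⟩, ?_⟩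
        rintro (_ | i | j)
        · exact D.rowStage_succ_subset m (ht ▸ h t)
        · exact (hf i).1
        · exact (hg j).1
      -- A challenge outside the family imposes no condition, so the old family is kept.
      · exact ⟨x, fun ht' => absurd ht' ht, fun t => D.rowStage_succ_subset m (h t)⟩

/-- The intersection of the iterates works. Saturation is used without parameters for nonemptiness,
and with parameters s and y to find witnesses lying in all iterates. -/
theorem exists_subset_step_of_rowStage [Nonempty M]
    (hM : (∃ (_ : Encodable (Σ n, L.Functions n)) (_ : Encodable (Σ n, L.Relations n)),
      IsRecursivelySaturated L M) ∨ Finite M)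
    (h : ∀ n, (D.rowStage M n).Nonempty) :
    ∃ X : Set (D.Row M), X.Nonempty ∧ X ⊆ D.step X := by
  refine ⟨{s | ∀ m, s ∈ D.rowStage M m}, ?_, fun s hs => ?_⟩
  · obtain ⟨x, -, hx⟩ := exists_forall_gameStage hM (⊤ : L.Formula (Empty ⊕ D.FamilyVar))
      D.moveFormula (M := M) Empty.elim fun m => by
        obtain ⟨s, hs⟩ := h m
        exact ⟨fun e => s e.2, BoundedFormula.realize_top.2 trivial,
          (D.gameStage_moveFormula_iff m _).2 fun _ => hs⟩
    exact ⟨fun c => x (none, c), fun m => (D.gameStage_moveFormula_iff m x).1 (hx m) none⟩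
  · have key : ∀ y : M, ∃ x : D.FamilyVar → M,
        D.linkFormula.Realize (Sum.elim (Sum.elim s fun _ => y) x) ∧
          ∀ m, GameStage D.moveFormula M m x := fun y => by
      refine exists_forall_gameStage hM D.linkFormula D.moveFormula _ fun m => ?_
      -- The constant family s survives m + 1 rounds; its answer to the challenge s, y is a family
      -- of witnesses surviving m rounds.
      have hm := (D.gameStage_moveFormula_iff (m + 1) fun e => s e.2).2 fun _ => hs (m + 1)
      obtain ⟨x, hx, hxm⟩ := hm (Sum.elim s fun _ => y)
      exact ⟨x, D.realize_moveFormula.1 hx ⟨none, rfl⟩, hxm⟩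
    simp only [realize_linkFormula, gameStage_moveFormula_iff] at key
    obtain ⟨y₀⟩ := ‹Nonempty M›
    obtain ⟨x₀, hx₀, hm₀⟩ := key y₀
    refine ⟨hx₀.1, fun i => ⟨_, fun m => hm₀ m _, hx₀.2.1 i⟩, fun y j => ?_⟩
    obtain ⟨x, hx, hm⟩ := key y
    exact ⟨_, fun m => hm m _, hx.2.2 j⟩

end NormalForm

end InclusionLogic

end

theorem theorem4p2 {L : FirstOrder.Language.{u, v}} (D : InclusionLogic.NormalForm L)
    (M : Type w) [L.Structure M] [Nontrivial M]
    (hM : (∃ (_ : Encodable (Σ n, L.Functions n)) (_ : Encodable (Σ n, L.Relations n)),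
        InclusionLogic.IsRecursivelySaturated L M) ∨ Finite M) :
    (D.ModelsGame M ↔ ∀ n : ℕ, M ⊨ D.approx n) ∧
    (Countable M → ∀ φ : InclusionLogic.IncSentence L,
      InclusionLogic.IncFormula.SemEquiv.{u, v, w} φ D.toInc →
        (φ.Models M ↔ ∀ n : ℕ, M ⊨ D.approx n)) := by
  have h : D.ModelsGame M ↔ ∀ n : ℕ, M ⊨ D.approx n :=
    ⟨fun h => h.realize_approx, fun h => D.modelsGame_iff.2
      (D.exists_subset_step_of_rowStage hM fun n => D.rowStage_nonempty (h n))⟩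
  refine ⟨h, fun _ φ hφ => ?_⟩
  rw [← h, D.modelsGame_iff, ← D.models_toInc_iff]
  exact hφ M _
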